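/- Let $L$ be a finite lattice. A *transfer system* on $L$ is a partial order $\to$ on $L$ such that $x\to y$ implies $x\le y$, and such that $x\to y$ and $z\le y$ imply $x\wedge z\to z$. It is *saturated* if, for all $x\le y\le z$, whenever two of $x\to y$, $x\to z$, $y\to z$ hold, so does the third. The saturated transfer systems on $L$, ordered by containment, form a finite lattice $\mathrm{Sat}(L)$. For a finite lattice $\Lambda$ with more than one element, let $J(\Lambda)$ and $M(\Lambda)$ be its sets of join-irreducible and meet-irreducible elements (the minimum is not counted as join-irreducible, nor the maximum as meet-irreducible). The *density* of $\Lambda$ is the proportion of entries equal to $1$ in its reduced formal context, the binary matrix of the relation $\le$ between $J(\Lambda)$ and $M(\Lambda)$: $$\delta(\Lambda)=\frac{\lvert\{(j,m)\in J(\Lambda)\times M(\Lambda): j\le m\}\rvert}{\lvert J(\Lambda)\rvert\,\lvert M(\Lambda)\rvert}.$$ For a prime $p$ and an integer $n\ge 1$ let $\delta(n,p)=\delta(\mathrm{Sat}(\mathrm{Sub}(C_p^n)))$, where $\mathrm{Sub}(C_p^n)$ is the subgroup lattice of the elementary abelian group $C_p^n$. **Theorem.** For every prime $p$, $$\lim_{n\to\infty}\delta(n,p)=1.$$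 For every integer $n\ge 1$, with $p$ tending to infinity through the primes, $$\lim_{p\to\infty}\delta(n,p)=\begin{cases}0 & n=1,\\ 1/2 & n=2,\\ 1 & n>2.\end{cases}$$ Moreover, $\delta(2,p)=1/2$ for every prime $p$. -/

import Mathlib

open Filter Topology

/-- A transfer system on a lattice `L`: a partial order `x → y` on `L` (written `rel x y`) refining
`≤` and stable under restriction. Antisymmetry is not a field because it follows from `le_of_rel`. -/
@[ext]
structure TransferSystem (L : Type*) [Lattice L] where
  rel : L → L → Prop
  rel_refl : ∀ x, rel x x
  rel_trans : ∀ x y z, rel x y → rel y z → rel x z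
  le_of_rel : ∀ x y, rel x y → x ≤ y
  restrict : ∀ x y z, rel x y → z ≤ y → rel (x ⊓ z) z

namespace TransferSystem

variable {L : Type*} [Lattice L]

/-- Transfer systems are ordered by containment of their sets of arrows. -/
instance : PartialOrder (TransferSystem L) :=
  PartialOrder.lift TransferSystem.rel fun _ _ h => TransferSystem.ext h

/-- A transfer system is saturated if its arrows satisfy the 2-out-of-3 property. -/
def IsSaturated (T : TransferSystem L) : Prop :=
  ∀ x y z : L, x ≤ y → y ≤ z →
    (T.rel x y → T.rel y z → T.rel x z) ∧
    (T.rel x y → T.rel x z → T.rel y z) ∧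
    (T.rel x z → T.rel y z → T.rel x y)

end TransferSystem

/-- The set of saturated transfer systems on `L`, ordered by containment. -/
abbrev Sat (L : Type*) [Lattice L] : Type _ :=
  {T : TransferSystem L // T.IsSaturated}

namespace Sat

variable {L : Type*} [Lattice L]

/-- The intersection of a set of saturated transfer systems (for the empty set: the relation `≤`). -/
def inter (S : Set (Sat L)) : Sat L where
  val :=
    { rel := fun x y => x ≤ y ∧ ∀ T ∈ S, T.1.rel x y
      rel_refl := fun x => ⟨le_rfl, fun T _ => T.1.rel_refl x⟩
      rel_trans := fun x y z h h' =>
        ⟨h.1.trans h'.1, fun T hT => T.1.rel_trans x y z (h.2 T hT) (h'.2 T hT)⟩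
      le_of_rel := fun _ _ h => h.1
      restrict := fun x y z h hz =>
        ⟨inf_le_right, fun T hT => T.1.restrict x y z (h.2 T hT) hz⟩ }
  property := fun x y z hxy hyz =>
    ⟨fun h h' => ⟨hxy.trans hyz, fun T hT => (T.2 x y z hxy hyz).1 (h.2 T hT) (h'.2 T hT)⟩,
     fun h h' => ⟨hyz, fun T hT => (T.2 x y z hxy hyz).2.1 (h.2 T hT) (h'.2 T hT)⟩,
     fun h h' => ⟨hxy, fun T hT => (T.2 x y z hxy hyz).2.2 (h.2 T hT) (h'.2 T hT)⟩⟩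

instance : InfSet (Sat L) := ⟨inter⟩

theorem isGLB_inter (S : Set (Sat L)) : IsGLB S (sInf S) :=
  ⟨fun T hT _ _ h => h.2 T hT,
   fun U hU x y h => ⟨U.1.le_of_rel x y h, fun _ hT => hU hT x y h⟩⟩

/-- The lattice of saturated transfer systems: meets are intersections, and the join of a family is
the smallest saturated transfer system containing it. -/
instance : CompleteLattice (Sat L) :=
  completeLatticeOfInf (Sat L) isGLB_inter

end Sat

/-- The reduced formal context of a finite lattice `L`: the relation `≤` between its
join-irreducible and its meet-irreducible elements. -/
def reducedContext (L : Type*) [Lattice L] (j : {j : L // SupIrred j}) (m : {m : L // InfIrred m}) :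
    Prop :=
  j.1 ≤ m.1

/-- The density of a relation between finite sets: the proportion of entries equal to `1` in the
corresponding binary matrix. -/
noncomputable def relDensity {α β : Type*} (R : α → β → Prop) : ℝ :=
  (Nat.card {q : α × β // R q.1 q.2} : ℝ) / ((Nat.card α : ℝ) * (Nat.card β : ℝ))

/-- The density `δ(L)` of a finite lattice, i.e. the density of its reduced formal context. -/
noncomputable def latticeDensity (L : Type*) [Lattice L] : ℝ :=
  relDensity (reducedContext L)

/-- The subgroup lattice of the group `C_p ^ n`, written additively as `(ℤ/p) ^ n`. -/
abbrev SubCpPow (p n : ℕ) : Type :=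
  AddSubgroup (Fin n → ZMod p)

/-! A saturated transfer system is determined by the elements that are not targets of nontrivial
arrows (`ofSet_stable`), so it is a meet of systems `ofSet {z}`; by 2-out-of-3 it is also generated
by its covering arrows (`le_of_forall_covBy`). Hence meet-irreducibles correspond to elements `z ≠
⊥` (`infIrred_iff`), join-irreducibles to covers `x ⋖ y` (`supIrred_iff`), and incidence fails
exactly when `z ≤ y` and `¬ z ≤ x`. So `1 - δ` is the number of such triples divided by the number
of covers times the number of nonzero elements (`latticeDensity_eq`).

For subspaces of an `n`-space over a field with `q` elements, these counts are sums of products of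
Gaussian binomials, each equal to `q ^ (d * (n - d))` up to a factor `2 ^ d`. With `d = dim y`, the
triples have exponent at most `d(n-d) + (d-1) + d²/4 ≤ (n+1)²/3 - 1`, while the denominator reaches
exponent `n(n+1)/2 - 1`. The gap `(n+1)(n-2)/6` is positive for `n ≥ 3` and quadratic in `n`, so it
beats the constant `32 ^ n` in both limits (`nonincidenceCount_mul_pow_le`). For `n = 1, 2` the
quotient is computed exactly. -/

namespace Sat

variable {L : Type*} [Lattice L]

/-- The saturated transfer system of the arrows `a → b` such that every `z ∈ Z` below `b` is
below `a`. -/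
def ofSet (Z : Set L) : Sat L where
  val :=
    { rel := fun a b => a ≤ b ∧ ∀ z ∈ Z, z ≤ b → z ≤ a
      rel_refl := fun _ => ⟨le_rfl, fun _ _ h => h⟩
      rel_trans := fun _ _ _ h h' =>
        ⟨h.1.trans h'.1, fun z hz hc => h.2 z hz (h'.2 z hz hc)⟩
      le_of_rel := fun _ _ h => h.1
      restrict := fun _ _ _ h hc =>
        ⟨inf_le_right, fun z hz hzc => le_inf (h.2 z hz (hzc.trans hc)) hzc⟩ }
  property := fun _ _ _ hxy hyz =>
    ⟨fun h h' => ⟨hxy.trans hyz, fun z hz hc => h.2 z hz (h'.2 z hz hc)⟩,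
     fun _ h' => ⟨hyz, fun z hz hc => (h'.2 z hz hc).trans hxy⟩,
     fun h _ => ⟨hxy, fun z hz hc => h.2 z hz (hc.trans hyz)⟩⟩

theorem rel_ofSet {Z : Set L} {a b : L} :
    (ofSet Z).1.rel a b ↔ a ≤ b ∧ ∀ z ∈ Z, z ≤ b → z ≤ a := Iff.rfl

/-- The elements that are not the target of a nontrivial arrow. -/
def stable (T : Sat L) : Set L := {z | ∀ x, T.1.rel x z → x = z}

theorem rel_inf {S T : Sat L} {a b : L} (hS : S.1.rel a b) (hT : T.1.rel a b) :
    (S ⊓ T).1.rel a b := by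
  have h : inter {S, T} ≤ S ⊓ T :=
    le_inf ((isGLB_inter {S, T}).1 (by simp)) ((isGLB_inter {S, T}).1 (by simp))
  refine h a b ⟨S.1.le_of_rel a b hS, ?_⟩
  rintro U (rfl | rfl) <;> assumption

/-- An arrow `a → b` factors through any `c` with `a ⋖ c ≤ b`: restriction gives `a → c`, then
2-out-of-3 gives `c → b`. -/
theorem le_of_forall_covBy [Finite L] {T U : Sat L}
    (h : ∀ x y, x ⋖ y → T.1.rel x y → U.1.rel x y) : T ≤ U := by
  intro a b hab
  induction a using (wellFounded_gt (α := L)).induction with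
  | _ a ih =>
    rcases (T.1.le_of_rel a b hab).eq_or_lt with rfl | hlt
    · exact U.1.rel_refl a
    · obtain ⟨c, hac, hcb⟩ := exists_covBy_le_of_lt hlt
      have h1 : T.1.rel a c := by
        have := T.1.restrict a b c hab hcb
        rwa [inf_eq_left.2 hac.le] at this
      exact U.1.rel_trans a c b (h a c hac h1) (ih c hac.lt ((T.2 a c b hac.le hcb).2.1 h1 hab))

theorem le_ofSet_iff {T : Sat L} {Z : Set L} : T ≤ ofSet Z ↔ Z ⊆ stable T := by
  constructor
  · intro h z hz x hx
    exact le_antisymm (T.1.le_of_rel x z hx) ((h x z hx).2 z hz le_rfl)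
  · intro h a b hab
    refine ⟨T.1.le_of_rel a b hab, fun z hz hzb => ?_⟩
    exact inf_eq_right.1 (h hz _ (T.1.restrict a b z hab hzb))

theorem ofSet_stable [Finite L] (T : Sat L) : ofSet (stable T) = T := by
  refine le_antisymm (fun a b hab => ?_) (le_ofSet_iff.2 subset_rfl)
  -- A minimal source `c` of arrows into `b` is stable by transitivity, hence lies below `a`; then
  -- `c → a` and `c → b` force `a → b`.
  obtain ⟨c, hc, hmin⟩ := (wellFounded_lt (α := L)).has_min {x | T.1.rel x b} ⟨b, T.1.rel_refl b⟩
  have hcs : c ∈ stable T := fun x hx =>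
    ((T.1.le_of_rel x c hx).eq_or_lt).resolve_right (hmin x (T.1.rel_trans x c b hx hc))
  have hca : c ≤ a := hab.2 c hcs (T.1.le_of_rel c b hc)
  have h1 : T.1.rel c a := by
    have := T.1.restrict c b a hc hab.1
    rwa [inf_eq_left.2 hca] at this
  exact (T.2 c a b hca hab.1).2.1 h1 hc

/-! ### Meet-irreducible saturated transfer systems -/

theorem eq_or_eq_bot_of_mem_stable [OrderBot L] {w z : L} (h : w ∈ stable (ofSet {z})) :
    w = z ∨ w = ⊥ := by
  by_cases hzw : z ≤ w
  · exact Or.inl (h z ⟨hzw, fun u hu _ => hu.le⟩).symm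
  · exact Or.inr (h ⊥ ⟨bot_le, fun u hu huw => absurd (hu ▸ huw) hzw⟩).symm

theorem mem_stable_ofSet {Z : Set L} {z : L} (hz : z ∈ Z) : z ∈ stable (ofSet Z) :=
  le_ofSet_iff.1 le_rfl hz

theorem ofSet_singleton_injective [OrderBot L] {z w : L} (hz : z ≠ ⊥)
    (h : ofSet {z} = ofSet {w}) : z = w :=
  (eq_or_eq_bot_of_mem_stable (h ▸ mem_stable_ofSet rfl)).resolve_right hz

/-- Every system strictly above `ofSet {z}` contains the arrow `⊥ → z`, which `ofSet {z}` lacks; so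
two of them cannot meet in `ofSet {z}`. -/
theorem infIrred_ofSet_singleton [OrderBot L] {z : L} (hz : z ≠ ⊥) :
    InfIrred (ofSet {z}) := by
  have key : ¬ (ofSet {z}).1.rel ⊥ z := fun h => hz (le_bot_iff.1 (h.2 z rfl le_rfl))
  have aux : ∀ A : Sat L, ofSet {z} ≤ A → ¬ A ≤ ofSet {z} → A.1.rel ⊥ z := by
    intro A hA hA'
    rw [le_ofSet_iff, Set.singleton_subset_iff] at hA'
    simp only [stable, Set.mem_ofPred_eq, not_forall] at hA'
    obtain ⟨a, ha, hne⟩ := hA'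
    have hlt := lt_of_le_of_ne (A.1.le_of_rel a z ha) hne
    refine A.1.rel_trans ⊥ a z (hA ⊥ a ⟨bot_le, fun u hu hua => ?_⟩) ha
    exact absurd (hu ▸ hua) hlt.not_ge
  refine ⟨fun hmax => key ?_, fun A B hAB => ?_⟩
  · exact hmax (b := ofSet ∅) (fun a b h => ⟨h.1, fun _ hz => hz.elim⟩) ⊥ z
      ⟨bot_le, fun _ hz => hz.elim⟩
  · by_contra! hcon
    refine key (hAB ▸ rel_inf (aux A (hAB ▸ inf_le_left) fun h => hcon.1 ?_)
      (aux B (hAB ▸ inf_le_right) fun h => hcon.2 ?_))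
    · exact le_antisymm h (hAB ▸ inf_le_left)
    · exact le_antisymm h (hAB ▸ inf_le_right)

theorem infIrred_iff [OrderBot L] [Finite L] {T : Sat L} :
    InfIrred T ↔ ∃ z : L, z ≠ ⊥ ∧ ofSet {z} = T := by
  refine ⟨fun hT => ?_, fun ⟨z, hz, h⟩ => h ▸ infIrred_ofSet_singleton hz⟩
  have hfin : (stable T).Finite := Set.toFinite _
  have h : hfin.toFinset.inf (fun z => ofSet {z}) = T := by
    refine le_antisymm ?_ (Finset.le_inf fun z hz => ?_)
    · conv_rhs => rw [← ofSet_stable T]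
      refine le_ofSet_iff.2 fun z hz => ?_
      exact le_ofSet_iff.1 (Finset.inf_le (f := fun z : L => ofSet {z})
        (hfin.mem_toFinset.2 hz)) rfl
    · exact le_ofSet_iff.2 (Set.singleton_subset_iff.2 (hfin.mem_toFinset.1 hz))
  obtain ⟨z, -, hz⟩ := hT.finset_inf_eq h
  refine ⟨z, ?_, hz⟩
  -- The system `ofSet {⊥}` is the top element, which is not meet-irreducible.
  rintro rfl
  refine hT.1 fun U _ a b hab => ?_
  rw [← hz]
  exact ⟨U.1.le_of_rel a b hab, fun u hu _ => hu.le.trans bot_le⟩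

/-! ### Join-irreducible saturated transfer systems -/

/-- The saturated transfer system generated by the arrow `x → y`. -/
def principal (x y : L) : Sat L := ofSet {z | z ≤ y → z ≤ x}

theorem rel_principal {x y : L} (h : x ≤ y) : (principal x y).1.rel x y :=
  ⟨h, fun _ hz => hz⟩

/-- If `T` contains `x → y` and `z ≤ y` is stable, restriction gives `x ⊓ z → z`, so `z ≤ x`: all
stable elements of `T` belong to the set defining `principal x y`. -/
theorem principal_le_iff [Finite L] {x y : L} (hxy : x ≤ y) {T : Sat L} :
    principal x y ≤ T ↔ T.1.rel x y := by
  refine ⟨fun h => h x y (rel_principal hxy), fun h => ?_⟩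
  rw [← ofSet_stable T]
  refine le_ofSet_iff.2 fun z hz => mem_stable_ofSet fun hzy => ?_
  exact inf_eq_right.1 (hz _ (T.1.restrict x y z h hzy))

theorem principal_le_ofSet_singleton [Finite L] {x y z : L} (hxy : x ≤ y) :
    principal x y ≤ ofSet {z} ↔ (z ≤ y → z ≤ x) := by
  rw [principal_le_iff hxy, rel_ofSet]
  simp [hxy]

theorem principal_injective {x y x' y' : L} (h : x < y) (h' : x' < y')
    (heq : principal x y = principal x' y') : x = x' ∧ y = y' := by
  have aux : ∀ {x y x' y' : L}, x < y → principal x y = principal x' y' → y ≤ y' := by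
    intro x y x' y' h heq
    by_contra hcon
    have := (heq ▸ rel_principal h.le : (principal x' y').1.rel x y).2 y
      (fun hy => absurd hy hcon) le_rfl
    exact h.not_ge this
  have aux' : ∀ {x y x' : L}, x < y → x' < y → principal x y = principal x' y → x' ≤ x := by
    intro x y x' h h' heq
    exact (heq ▸ rel_principal h.le : (principal x' y).1.rel x y).2 x' (fun _ => le_rfl) h'.le
  obtain rfl := le_antisymm (aux h heq) (aux h' heq.symm)
  exact ⟨le_antisymm (aux' h' h heq.symm) (aux' h h' heq), rfl⟩

/-- Any system strictly below `principal x y` has `y` stable, since a source of an arrow into `y`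
lies between `x` and `y`. Hence it lies below `ofSet {y}`, and so do joins of two such systems, but
`principal x y` does not. -/
theorem supIrred_principal [Finite L] {x y : L} (h : x ⋖ y) : SupIrred (principal x y) := by
  have aux : ∀ A : Sat L, A ≤ principal x y → A ≠ principal x y → A ≤ ofSet {y} := by
    intro A hA hne
    refine le_ofSet_iff.2 (Set.singleton_subset_iff.2 fun a ha => ?_)
    have hxa : x ≤ a := (hA a y ha).2 x (fun _ => le_rfl) h.le
    refine (h.eq_or_eq hxa (A.1.le_of_rel a y ha)).resolve_left ?_
    rintro rfl
    exact hne (le_antisymm hA ((principal_le_iff h.le).2 ha))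
  refine ⟨fun hmin => ?_, fun A B hAB => ?_⟩
  · have h1 : ofSet Set.univ ≤ principal x y := le_ofSet_iff.2 fun z _ =>
      mem_stable_ofSet (Set.mem_univ z)
    have h2 := hmin h1 x y (rel_principal h.le)
    exact h.lt.not_ge (h2.2 y (Set.mem_univ y) le_rfl)
  · by_contra! hcon
    have h1 : principal x y ≤ ofSet {y} := hAB ▸ sup_le (aux A (hAB ▸ le_sup_left) hcon.1)
      (aux B (hAB ▸ le_sup_right) hcon.2)
    exact h.lt.not_ge ((principal_le_ofSet_singleton h.le).1 h1 le_rfl)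

theorem supIrred_iff [Finite L] {T : Sat L} :
    SupIrred T ↔ ∃ x y : L, x ⋖ y ∧ principal x y = T := by
  refine ⟨fun hT => ?_, fun ⟨x, y, hxy, h⟩ => h ▸ supIrred_principal hxy⟩
  have hfin : {q : L × L | q.1 ⋖ q.2 ∧ T.1.rel q.1 q.2}.Finite := Set.toFinite _
  have h : hfin.toFinset.sup (fun q => principal q.1 q.2) = T := by
    refine le_antisymm (Finset.sup_le fun q hq => ?_) (le_of_forall_covBy fun x y hxy h => ?_)
    · rw [hfin.mem_toFinset] at hq
      exact (principal_le_iff hq.1.le).2 hq.2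
    · exact (principal_le_iff hxy.le).1 (Finset.le_sup (f := fun q : L × L => principal q.1 q.2)
        (hfin.mem_toFinset.2 (show (x, y) ∈ _ from ⟨hxy, h⟩)))
  obtain ⟨q, hq, hqT⟩ := hT.finset_sup_eq h
  exact ⟨q.1, q.2, (hfin.mem_toFinset.1 hq).1, hqT⟩

/-! ### The reduced context and its density -/

/-- Join-irreducible saturated transfer systems correspond to covering pairs. -/
noncomputable def covByEquiv (L : Type*) [Lattice L] [Finite L] :
    {q : L × L // q.1 ⋖ q.2} ≃ {T : Sat L // SupIrred T} :=
  Equiv.ofBijective (fun q => ⟨principal q.1.1 q.1.2, supIrred_principal q.2⟩)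
    ⟨fun q r h => by
      have := principal_injective q.2.lt r.2.lt (Subtype.ext_iff.1 h)
      exact Subtype.ext (Prod.ext this.1 this.2),
     fun ⟨T, hT⟩ => by
      obtain ⟨x, y, hxy, rfl⟩ := supIrred_iff.1 hT
      exact ⟨⟨(x, y), hxy⟩, rfl⟩⟩

/-- Meet-irreducible saturated transfer systems correspond to the elements other than `⊥`. -/
noncomputable def neBotEquiv (L : Type*) [Lattice L] [OrderBot L] [Finite L] :
    {z : L // z ≠ ⊥} ≃ {T : Sat L // InfIrred T} :=
  Equiv.ofBijective (fun z => ⟨ofSet {z.1}, infIrred_ofSet_singleton z.2⟩)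
    ⟨fun z w h => Subtype.ext (ofSet_singleton_injective z.2 (Subtype.ext_iff.1 h)),
     fun ⟨T, hT⟩ => by
      obtain ⟨z, hz, rfl⟩ := infIrred_iff.1 hT
      exact ⟨⟨z, hz⟩, rfl⟩⟩

theorem card_incident_add_card_nonincident (L : Type*) [Lattice L] [OrderBot L] [Finite L] :
    Nat.card {q : {j : Sat L // SupIrred j} × {m : Sat L // InfIrred m} //
        reducedContext (Sat L) q.1 q.2} +
      Nat.card {t : (L × L) × L // t.1.1 ⋖ t.1.2 ∧ t.2 ≤ t.1.2 ∧ ¬ t.2 ≤ t.1.1} =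
    Nat.card {q : L × L // q.1 ⋖ q.2} * Nat.card {z : L // z ≠ ⊥} := by
  classical
  let e := (covByEquiv L).prodCongr (neBotEquiv L)
  have h1 : Nat.card {q : {j : Sat L // SupIrred j} × {m : Sat L // InfIrred m} //
      reducedContext (Sat L) q.1 q.2} =
      Nat.card {r : {q : L × L // q.1 ⋖ q.2} × {z : L // z ≠ ⊥} //
        r.2.1 ≤ r.1.1.2 → r.2.1 ≤ r.1.1.1} := by
    refine (Nat.card_congr (e.subtypeEquiv fun r => ?_)).symm
    exact (principal_le_ofSet_singleton r.1.2.le).symm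
  have h2 : Nat.card {t : (L × L) × L // t.1.1 ⋖ t.1.2 ∧ t.2 ≤ t.1.2 ∧ ¬ t.2 ≤ t.1.1} =
      Nat.card {r : {q : L × L // q.1 ⋖ q.2} × {z : L // z ≠ ⊥} //
        ¬ (r.2.1 ≤ r.1.1.2 → r.2.1 ≤ r.1.1.1)} := by
    -- The condition `z ≠ ⊥` is automatic here, because `¬ z ≤ x`.
    refine Nat.card_congr
      ⟨fun t => ⟨(⟨t.1.1, t.2.1⟩, ⟨t.1.2, fun h => t.2.2.2 (h ▸ bot_le)⟩), fun h =>
          t.2.2.2 (h t.2.2.1)⟩,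
        fun r => ⟨(r.1.1.1, r.1.2.1), r.1.1.2, Classical.not_imp.1 r.2⟩,
        fun _ => rfl, fun _ => rfl⟩
  rw [h1, h2, ← Nat.card_prod, ← Nat.card_sum]
  exact Nat.card_congr (Equiv.sumCompl _)

theorem latticeDensity_eq (L : Type*) [Lattice L] [OrderBot L] [Finite L]
    (hc : Nat.card {q : L × L // q.1 ⋖ q.2} ≠ 0) (hz : Nat.card {z : L // z ≠ ⊥} ≠ 0) :
    latticeDensity (Sat L) =
      1 - (Nat.card {t : (L × L) × L // t.1.1 ⋖ t.1.2 ∧ t.2 ≤ t.1.2 ∧ ¬ t.2 ≤ t.1.1} : ℝ) /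
        (Nat.card {q : L × L // q.1 ⋖ q.2} * Nat.card {z : L // z ≠ ⊥}) := by
  have h := card_incident_add_card_nonincident L
  rw [latticeDensity, relDensity, ← Nat.card_congr (covByEquiv L), ← Nat.card_congr (neBotEquiv L)]
  have hc' : (Nat.card {q : L × L // q.1 ⋖ q.2} : ℝ) ≠ 0 := Nat.cast_ne_zero.2 hc
  have hz' : (Nat.card {z : L // z ≠ ⊥} : ℝ) ≠ 0 := Nat.cast_ne_zero.2 hz
  have h' := congrArg (Nat.cast (R := ℝ)) h
  push_cast at h'
  rw [eq_sub_iff_add_eq, ← add_div, h', div_self (mul_ne_zero hc' hz')]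

end Sat

/-! ### Counting subspaces, covers and triples -/

open Module

theorem Submodule.covBy_iff_finrank_add_one_eq {K V : Type*} [DivisionRing K] [AddCommGroup V]
    [Module K V] [FiniteDimensional K V] {x y : Submodule K V} :
    x ⋖ y ↔ x ≤ y ∧ finrank K x + 1 = finrank K y := by
  constructor
  · intro h
    obtain ⟨v, hvy, hvx⟩ := SetLike.exists_of_lt h.lt
    have hle : K ∙ v ⊔ x ≤ y := sup_le ((Submodule.span_singleton_le_iff_mem v y).2 hvy) h.le
    have heq : K ∙ v ⊔ x = y :=
      (h.eq_or_eq le_sup_right hle).resolve_left (Submodule.covBy_span_singleton_sup hvx).lt.ne'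
    have h1 := Submodule.finrank_add_le_finrank_add_finrank (K ∙ v) x
    have h2 : finrank K (K ∙ v) = 1 :=
      finrank_span_singleton fun h0 => hvx (h0 ▸ x.zero_mem)
    have h3 := Submodule.finrank_lt_finrank_of_lt h.lt
    rw [heq] at h1
    exact ⟨h.le, by lia⟩
  · rintro ⟨hle, h⟩
    refine ⟨lt_of_le_of_ne hle fun he => by subst he; lia, fun z hxz hzy => ?_⟩
    have h1 := Submodule.finrank_lt_finrank_of_lt hxz
    have h2 := Submodule.finrank_lt_finrank_of_lt hzy
    lia

section Counting

variable (K : Type*) [Field K]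

/-- The number of `k`-dimensional subspaces of `K ^ n`. -/
noncomputable def grassmannCard (n k : ℕ) : ℕ :=
  Nat.card {W : Submodule K (Fin n → K) // finrank K W = k}

/-- The number of subspaces of `K ^ n`. -/
noncomputable def subspaceCard (n : ℕ) : ℕ :=
  Nat.card (Submodule K (Fin n → K))

/-- The number of hyperplanes of `K ^ n`. -/
noncomputable def hyperplaneCard (n : ℕ) : ℕ :=
  Nat.card {W : Submodule K (Fin n → K) // finrank K W + 1 = n}

@[simp]
theorem hyperplaneCard_zero : hyperplaneCard K 0 = 0 := by
  simp [hyperplaneCard]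

@[simp]
theorem hyperplaneCard_succ (n : ℕ) : hyperplaneCard K (n + 1) = grassmannCard K (n + 1) n := by
  simp [hyperplaneCard, grassmannCard]

theorem grassmannCard_zero_right (n : ℕ) : grassmannCard K n 0 = 1 := by
  rw [grassmannCard, Nat.card_eq_one_iff_unique]
  refine ⟨⟨fun a b => Subtype.ext ?_⟩, ⟨⊥, by simp⟩⟩
  rw [Submodule.finrank_eq_zero.1 a.2, Submodule.finrank_eq_zero.1 b.2]

theorem grassmannCard_self (n : ℕ) : grassmannCard K n n = 1 := by
  rw [grassmannCard, Nat.card_eq_one_iff_unique]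
  refine ⟨⟨fun a b => Subtype.ext ?_⟩, ⟨⊤, by simp⟩⟩
  rw [Submodule.eq_top_of_finrank_eq (a.2.trans (by simp)),
    Submodule.eq_top_of_finrank_eq (b.2.trans (by simp))]

variable {K} {V : Type*} [AddCommGroup V] [Module K V] [FiniteDimensional K V]

theorem card_submodule_finrank (P : ℕ → Prop) :
    Nat.card {W : Submodule K V // P (finrank K W)} =
      Nat.card {W : Submodule K (Fin (finrank K V) → K) // P (finrank K W)} := by
  let e : V ≃ₗ[K] (Fin (finrank K V) → K) := LinearEquiv.ofFinrankEq _ _ (by simp)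
  refine Nat.card_congr ((Submodule.orderIsoMapComap e).toEquiv.subtypeEquiv fun W => ?_)
  exact iff_of_eq (congrArg P (LinearEquiv.finrank_map_eq e W).symm)

theorem card_submodule_le_finrank (y : Submodule K V) (P : ℕ → Prop) :
    Nat.card {x : Submodule K V // x ≤ y ∧ P (finrank K x)} =
      Nat.card {W : Submodule K (Fin (finrank K y) → K) // P (finrank K W)} := by
  rw [← card_submodule_finrank (V := y)]
  have e : {W : Submodule K y // P (finrank K W)} ≃
      {x : {x : Submodule K V // x ≤ y} // P (finrank K x.1)} :=
    y.mapIic.toEquiv.subtypeEquiv fun W =>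
      iff_of_eq (congrArg P (Submodule.finrank_map_subtype_eq y W).symm)
  exact Nat.card_congr (e.trans (Equiv.subtypeSubtypeEquivSubtypeInter (fun x => x ≤ y)
    fun x => P (finrank K x))).symm

theorem card_submodule_le (y : Submodule K V) :
    Nat.card {x : Submodule K V // x ≤ y} = subspaceCard K (finrank K y) := by
  have h := card_submodule_le_finrank y fun _ => True
  simp only [and_true] at h
  rw [h, subspaceCard]
  exact Nat.card_congr (Equiv.subtypeUnivEquiv fun _ => trivial)

theorem card_submodule_covBy (y : Submodule K V) :
    Nat.card {x : Submodule K V // x ⋖ y} = hyperplaneCard K (finrank K y) := by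
  simp_rw [Submodule.covBy_iff_finrank_add_one_eq]
  exact card_submodule_le_finrank y fun d => d + 1 = finrank K y

theorem sum_finrank_submodule {n : ℕ} [Fintype (Submodule K (Fin n → K))] (f : ℕ → ℕ) :
    ∑ y : Submodule K (Fin n → K), f (finrank K y) =
      ∑ k ∈ Finset.range (n + 1), grassmannCard K n k * f k := by
  classical
  rw [← Finset.sum_fiberwise_of_maps_to (t := Finset.range (n + 1))
    (g := fun y : Submodule K (Fin n → K) => finrank K y)]
  · refine Finset.sum_congr rfl fun k _ => ?_
    rw [Finset.sum_congr rfl (g := fun _ => f k) fun y hy => by rw [(Finset.mem_filter.1 hy).2],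
      Finset.sum_const, smul_eq_mul, grassmannCard, Nat.card_eq_fintype_card, Fintype.card_subtype]
  · intro y _
    have := Submodule.finrank_le y
    simp only [finrank_fin_fun] at this
    exact Finset.mem_range_succ_iff.2 this

variable [Finite K]

theorem card_submodule_le_not_le {x y : Submodule K V} (h : x ≤ y) :
    Nat.card {z : Submodule K V // z ≤ y ∧ ¬ z ≤ x} =
      subspaceCard K (finrank K y) - subspaceCard K (finrank K x) := by
  have : Finite V := Module.finite_of_finite K
  rw [← card_submodule_le y, ← card_submodule_le x]
  refine (Nat.sub_eq_of_eq_add ?_).symm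
  rw [← Nat.card_sum]
  classical
  refine Nat.card_congr ((Equiv.sumCompl fun z : {z // z ≤ y} => z.1 ≤ x).symm.trans
    ((Equiv.sumComm _ _).trans (Equiv.sumCongr ?_ ?_)))
  · exact Equiv.subtypeSubtypeEquivSubtypeInter (fun z => z ≤ y) fun z => ¬ z ≤ x
  · exact Equiv.subtypeSubtypeEquivSubtype (p := (· ≤ y)) (q := (· ≤ x)) fun hz => le_trans hz h

variable (K) (n : ℕ)

theorem subspaceCard_eq_sum :
    subspaceCard K n = ∑ k ∈ Finset.range (n + 1), grassmannCard K n k := by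
  have := Fintype.ofFinite (Submodule K (Fin n → K))
  have h := sum_finrank_submodule (K := K) (n := n) fun _ => 1
  simpa [subspaceCard, Nat.card_eq_fintype_card] using h

theorem card_covBy_submodule :
    Nat.card {q : Submodule K (Fin n → K) × Submodule K (Fin n → K) // q.1 ⋖ q.2} =
      ∑ k ∈ Finset.range n, grassmannCard K n (k + 1) * grassmannCard K (k + 1) k := by
  have := Fintype.ofFinite (Submodule K (Fin n → K))
  have e : {q : Submodule K (Fin n → K) × Submodule K (Fin n → K) // q.1 ⋖ q.2} ≃
      Σ y : Submodule K (Fin n → K), {x // x ⋖ y} :=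
    ⟨fun q => ⟨q.1.2, q.1.1, q.2⟩, fun s => ⟨(s.2.1, s.1), s.2.2⟩, fun _ => rfl, fun _ => rfl⟩
  rw [Nat.card_congr e, Nat.card_sigma]
  simp_rw [card_submodule_covBy]
  rw [sum_finrank_submodule, Finset.sum_range_succ']
  simp

theorem card_covBy_le_not_le_submodule :
    Nat.card {t : (Submodule K (Fin n → K) × Submodule K (Fin n → K)) × Submodule K (Fin n → K) //
        t.1.1 ⋖ t.1.2 ∧ t.2 ≤ t.1.2 ∧ ¬ t.2 ≤ t.1.1} =
      ∑ k ∈ Finset.range n, grassmannCard K n (k + 1) *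
        (grassmannCard K (k + 1) k * (subspaceCard K (k + 1) - subspaceCard K k)) := by
  classical
  have := Fintype.ofFinite (Submodule K (Fin n → K))
  have e : {t : (Submodule K (Fin n → K) × Submodule K (Fin n → K)) × Submodule K (Fin n → K) //
        t.1.1 ⋖ t.1.2 ∧ t.2 ≤ t.1.2 ∧ ¬ t.2 ≤ t.1.1} ≃
      Σ y : Submodule K (Fin n → K), Σ x : {x // x ⋖ y}, {z // z ≤ y ∧ ¬ z ≤ x.1} :=
    ⟨fun t => ⟨t.1.1.2, ⟨t.1.1.1, t.2.1⟩, t.1.2, t.2.2⟩,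
      fun s => ⟨((s.2.1.1, s.1), s.2.2.1), s.2.1.2, s.2.2.2⟩, fun _ => rfl, fun _ => rfl⟩
  have h : ∀ y : Submodule K (Fin n → K),
      Nat.card (Σ x : {x // x ⋖ y}, {z // z ≤ y ∧ ¬ z ≤ x.1}) =
        (fun d => hyperplaneCard K d * (subspaceCard K d - subspaceCard K (d - 1)))
          (finrank K y) := by
    intro y
    rw [Nat.card_sigma, Finset.sum_congr rfl (g := fun _ =>
      subspaceCard K (finrank K y) - subspaceCard K (finrank K y - 1)), Finset.sum_const,
      smul_eq_mul, Finset.card_univ, ← Nat.card_eq_fintype_card, card_submodule_covBy]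
    intro x _
    rw [card_submodule_le_not_le x.2.le, ← (Submodule.covBy_iff_finrank_add_one_eq.1 x.2).2,
      Nat.add_sub_cancel]
  rw [Nat.card_congr e, Nat.card_sigma]
  -- The term of dimension `0` vanishes since `hyperplaneCard K 0 = 0`, so the truncated `d - 1` is
  -- harmless and the sum can be reindexed by `d = k + 1`.
  rw [Finset.sum_congr rfl fun y _ => h y, sum_finrank_submodule
    fun d => hyperplaneCard K d * (subspaceCard K d - subspaceCard K (d - 1)),
    Finset.sum_range_succ']
  simp

theorem card_linearIndependent_range (k : ℕ) (W : Submodule K V) (hW : finrank K W = k) :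
    Nat.card {s : {s : Fin k → V // LinearIndependent K s} //
        Submodule.span K (Set.range s.1) = W} =
      ∏ i : Fin k, (Nat.card K ^ k - Nat.card K ^ i.val) := by
  have := Fintype.ofFinite K
  have : Finite V := Module.finite_of_finite K
  have h := card_linearIndependent (K := K) (V := W) hW.ge
  rw [hW, ← Nat.card_eq_fintype_card] at h
  rw [← h]
  refine Nat.card_congr ⟨fun s => ⟨fun i => ⟨s.1.1 i, ?_⟩, ?_⟩,
    fun s => ⟨⟨fun i => s.1 i, ?_⟩, ?_⟩, fun _ => rfl, fun _ => rfl⟩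
  · exact s.2.le (Submodule.subset_span ⟨i, rfl⟩)
  · exact LinearIndependent.of_comp W.subtype s.1.2
  · exact s.2.map' W.subtype W.ker_subtype
  · refine Submodule.eq_of_le_of_finrank_eq (Submodule.span_le.2 ?_) ?_
    · rintro _ ⟨i, rfl⟩
      exact (s.1 i).2
    · rw [hW]
      exact (finrank_span_eq_card (s.2.map' W.subtype W.ker_subtype)).trans (Fintype.card_fin k)

/-- Double count of linearly independent `k`-tuples, fibred over their span. -/
theorem grassmannCard_mul_prod {k : ℕ} (hk : k ≤ n) :
    grassmannCard K n k * ∏ i : Fin k, (Nat.card K ^ k - Nat.card K ^ i.val) =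
      ∏ i : Fin k, (Nat.card K ^ n - Nat.card K ^ i.val) := by
  classical
  have := Fintype.ofFinite K
  have := Fintype.ofFinite {W : Submodule K (Fin n → K) // finrank K W = k}
  have h := card_linearIndependent (K := K) (V := Fin n → K) (k := k) (by simpa using hk)
  rw [finrank_fin_fun, ← Nat.card_eq_fintype_card] at h
  let f : {s : Fin k → (Fin n → K) // LinearIndependent K s} →
      {W : Submodule K (Fin n → K) // finrank K W = k} := fun s =>
    ⟨Submodule.span K (Set.range s.1), by simpa using finrank_span_eq_card s.2⟩
  rw [← h, ← Nat.card_congr (Equiv.sigmaFiberEquiv f), Nat.card_sigma]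
  have h1 : ∀ W, Nat.card {s // f s = W} =
      ∏ i : Fin k, (Nat.card K ^ k - Nat.card K ^ i.val) := by
    intro W
    rw [← card_linearIndependent_range K k W.1 W.2]
    exact Nat.card_congr (Equiv.subtypeEquivRight fun s => Subtype.ext_iff)
  simp_rw [h1]
  rw [Finset.sum_const, smul_eq_mul, Finset.card_univ, grassmannCard, Nat.card_eq_fintype_card]

variable {n}

theorem prod_pow_sub_pow_pos {q : ℕ} (hq : 2 ≤ q) (k : ℕ) :
    0 < ∏ i : Fin k, (q ^ k - q ^ i.val) :=
  Finset.prod_pos fun i _ => Nat.sub_pos_of_lt (Nat.pow_lt_pow_right hq i.2)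

/-- Factor by factor, `q ^ n - q ^ i ≥ q ^ (n - k) * (q ^ k - q ^ i)`. -/
theorem pow_le_grassmannCard {k : ℕ} (hk : k ≤ n) :
    Nat.card K ^ (k * (n - k)) ≤ grassmannCard K n k := by
  have hq : 2 ≤ Nat.card K := Finite.one_lt_card
  refine Nat.le_of_mul_le_mul_right ?_ (prod_pow_sub_pow_pos hq k)
  rw [grassmannCard_mul_prod K n hk, mul_comm k, pow_mul]
  have h : (Nat.card K ^ (n - k)) ^ k = ∏ _i : Fin k, Nat.card K ^ (n - k) := by simp
  rw [h, ← Finset.prod_mul_distrib]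
  refine Finset.prod_le_prod' fun i _ => ?_
  rw [Nat.mul_sub, ← pow_add, Nat.sub_add_cancel hk]
  exact Nat.sub_le_sub_left (Nat.le_mul_of_pos_left _ (by positivity)) _

/-- Since `2 * q ^ i ≤ q ^ k` for `i < k`, each factor of the quotient is at most `2 * q ^ (n - k)`.
-/
theorem grassmannCard_le {k : ℕ} (hk : k ≤ n) :
    grassmannCard K n k ≤ 2 ^ k * Nat.card K ^ (k * (n - k)) := by
  have hq : 2 ≤ Nat.card K := Finite.one_lt_card
  refine Nat.le_of_mul_le_mul_right ?_ (prod_pow_sub_pow_pos hq k)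
  rw [grassmannCard_mul_prod K n hk, mul_comm k, pow_mul, ← mul_pow]
  have h : (2 * Nat.card K ^ (n - k)) ^ k = ∏ _i : Fin k, 2 * Nat.card K ^ (n - k) := by simp
  rw [h, ← Finset.prod_mul_distrib]
  refine Finset.prod_le_prod' fun i _ => (Nat.sub_le _ _).trans ?_
  have h1 : 2 * Nat.card K ^ i.val ≤ Nat.card K ^ k :=
    (Nat.mul_le_mul_right _ hq).trans (by
      rw [← pow_succ']
      exact Nat.pow_le_pow_right (by lia) i.2)
  calc Nat.card K ^ n = Nat.card K ^ (n - k) * Nat.card K ^ k := by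
        rw [← pow_add, Nat.sub_add_cancel hk]
    _ ≤ Nat.card K ^ (n - k) * (2 * (Nat.card K ^ k - Nat.card K ^ i.val)) :=
        Nat.mul_le_mul_left _ (by lia)
    _ = _ := by ring

end Counting

/-! ### Asymptotic bounds -/

section Bounds

variable (K : Type*) [Field K]

/-- The number of covering pairs of subspaces of `K ^ n`. -/
noncomputable def coverCount (n : ℕ) : ℕ :=
  ∑ k ∈ Finset.range n, grassmannCard K n (k + 1) * grassmannCard K (k + 1) k

/-- The number of pairs of a covering pair `x ⋖ y` of subspaces of `K ^ n` and a subspace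
contained in `y` but not in `x`. -/
noncomputable def nonincidenceCount (n : ℕ) : ℕ :=
  ∑ k ∈ Finset.range n, grassmannCard K n (k + 1) *
    (grassmannCard K (k + 1) k * (subspaceCard K (k + 1) - subspaceCard K k))

variable [Finite K]

theorem grassmannCard_pos {n k : ℕ} (hk : k ≤ n) : 0 < grassmannCard K n k :=
  (Nat.pow_pos Nat.card_pos).trans_le (pow_le_grassmannCard K hk)

theorem pow_le_coverCount {n k : ℕ} (hk : k < n) :
    Nat.card K ^ ((k + 1) * (n - (k + 1)) + k) ≤ coverCount K n := by
  refine le_trans ?_ (Finset.single_le_sum (f := fun k =>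
    grassmannCard K n (k + 1) * grassmannCard K (k + 1) k) (fun _ _ => Nat.zero_le _)
    (Finset.mem_range.2 hk))
  rw [pow_add]
  refine Nat.mul_le_mul (pow_le_grassmannCard K hk) ?_
  simpa using pow_le_grassmannCard K (Nat.le_succ k)

theorem coverCount_pos {n : ℕ} (hn : 1 ≤ n) : 0 < coverCount K n :=
  (Nat.pow_pos Nat.card_pos).trans_le (pow_le_coverCount K (k := 0) hn)

theorem pow_le_subspaceCard_sub_one {n k : ℕ} (hk : k < n) :
    Nat.card K ^ ((k + 1) * (n - (k + 1))) ≤ subspaceCard K n - 1 := by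
  rw [subspaceCard_eq_sum, Finset.sum_range_succ', grassmannCard_zero_right, Nat.add_sub_cancel]
  exact (pow_le_grassmannCard K hk).trans (Finset.single_le_sum
    (f := fun k => grassmannCard K n (k + 1)) (fun _ _ => Nat.zero_le _) (Finset.mem_range.2 hk))

theorem subspaceCard_sub_one_pos {n : ℕ} (hn : 1 ≤ n) : 0 < subspaceCard K n - 1 :=
  (Nat.pow_pos Nat.card_pos).trans_le (pow_le_subspaceCard_sub_one K (k := 0) hn)

theorem Nat.mul_sub_le_sq_div_four (m j : ℕ) (hj : j ≤ m) : j * (m - j) ≤ m * m / 4 := by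
  obtain ⟨i, rfl⟩ := Nat.exists_eq_add_of_le hj
  rw [Nat.add_sub_cancel_left, Nat.le_div_iff_mul_le (by norm_num)]
  zify
  nlinarith [sq_nonneg ((j : ℤ) - i)]

theorem subspaceCard_le (m : ℕ) : subspaceCard K m ≤ 4 ^ m * Nat.card K ^ (m * m / 4) := by
  have hq : 0 < Nat.card K := Nat.card_pos
  rw [subspaceCard_eq_sum]
  calc ∑ j ∈ Finset.range (m + 1), grassmannCard K m j
      ≤ ∑ _j ∈ Finset.range (m + 1), 2 ^ m * Nat.card K ^ (m * m / 4) := by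
        refine Finset.sum_le_sum fun j hj => ?_
        have hj := Finset.mem_range_succ_iff.1 hj
        exact (grassmannCard_le K hj).trans (Nat.mul_le_mul
          (Nat.pow_le_pow_right (by norm_num) hj)
          (Nat.pow_le_pow_right hq (Nat.mul_sub_le_sq_div_four m j hj)))
    _ = (m + 1) * 2 ^ m * Nat.card K ^ (m * m / 4) := by simp [mul_assoc]
    _ ≤ 2 ^ m * 2 ^ m * Nat.card K ^ (m * m / 4) := by
        gcongr
        exact Nat.lt_two_pow_self
    _ = _ := by rw [← mul_pow]; norm_num

/-- The exponent in the bound of `nonincidenceCount_mul_pow_le`. -/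
def decayExponent (n : ℕ) : ℕ := ((n + 1) * (n - 2) + 5) / 6

/-- The right side takes the dimensions `⌈n/2⌉` and `⌊n/2⌋`, which maximise the exponents for covers
and for subspaces; it equals `n(n+1)/2 - 1`. The left side is a concave quadratic in `d = k + 1`
with real maximum at `d = 2(n+1)/3`. The `+ 5` in `decayExponent` rounds the gap `(n+1)(n-2)/6` up,
as integrality allows. -/
theorem exponent_add_decayExponent_le {n k : ℕ} (hn : 2 ≤ n) (hk : k < n) :
    (k + 1) * (n - (k + 1)) + k + (k + 1) * (k + 1) / 4 + decayExponent n ≤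
      ((n - 1) / 2 + 1) * (n - ((n - 1) / 2 + 1)) + (n - 1) / 2 +
        ((n / 2 - 1) + 1) * (n - ((n / 2 - 1) + 1)) := by
  obtain ⟨i, hi⟩ := Nat.exists_eq_add_of_le hk
  have he : 6 * decayExponent n ≤ (n + 1) * (n - 2) + 5 := Nat.mul_div_le _ _
  have hf : 4 * ((k + 1) * (k + 1) / 4) ≤ (k + 1) * (k + 1) := Nat.mul_div_le _ _
  have hr : 2 * (((n - 1) / 2 + 1) * (n - ((n - 1) / 2 + 1)) + (n - 1) / 2 +
      ((n / 2 - 1) + 1) * (n - ((n / 2 - 1) + 1))) + 2 = n * (n + 1) := by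
    obtain ⟨a, rfl | rfl⟩ := Nat.even_or_odd' n
    · obtain ⟨a, rfl⟩ := Nat.exists_eq_add_of_le' (show 1 ≤ a by lia)
      rw [show (2 * (a + 1) - 1) / 2 = a by lia, show 2 * (a + 1) / 2 - 1 = a by lia,
        show 2 * (a + 1) - (a + 1) = a + 1 by lia]
      ring
    · obtain ⟨a, rfl⟩ := Nat.exists_eq_add_of_le' (show 1 ≤ a by lia)
      rw [show (2 * (a + 1) + 1 - 1) / 2 = a + 1 by lia,
        show (2 * (a + 1) + 1) / 2 - 1 = a by lia,
        show 2 * (a + 1) + 1 - (a + 1 + 1) = a + 1 by lia,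
        show 2 * (a + 1) + 1 - (a + 1) = a + 2 by lia]
      ring
  generalize ((n - 1) / 2 + 1) * (n - ((n - 1) / 2 + 1)) + (n - 1) / 2 +
        ((n / 2 - 1) + 1) * (n - ((n / 2 - 1) + 1)) = r at hr ⊢
  generalize decayExponent n = e at he ⊢
  generalize (k + 1) * (k + 1) / 4 = f at hf ⊢
  obtain ⟨m, rfl⟩ := Nat.exists_eq_add_of_le' hn
  rw [show m + 2 - (k + 1) = i by lia]
  rw [Nat.add_sub_cancel] at he
  have hm : m + 1 = k + i := by lia
  -- Proving a strict bound against `r + 1` absorbs the rounding; the square used below is `(2(n+1)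
  -- - 3d)²`.
  suffices h : 12 * ((k + 1) * i + k + f + e) < 12 * (r + 1) by lia
  zify at *
  have hm' : (m : ℤ) = k + i - 1 := by lia
  rw [hm'] at hr he
  nlinarith [sq_nonneg (2 * ((k : ℤ) + i + 2) - 3 * (k + 1))]

theorem nonincidenceCount_mul_pow_le {n : ℕ} (hn : 2 ≤ n) :
    nonincidenceCount K n * Nat.card K ^ decayExponent n ≤
      32 ^ n * (coverCount K n * (subspaceCard K n - 1)) := by
  have hq : 0 < Nat.card K := Nat.card_pos
  set M := ((n - 1) / 2 + 1) * (n - ((n - 1) / 2 + 1)) + (n - 1) / 2 +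
        ((n / 2 - 1) + 1) * (n - ((n / 2 - 1) + 1)) with hM
  have h1 : Nat.card K ^ M ≤ coverCount K n * (subspaceCard K n - 1) := by
    rw [hM, pow_add]
    exact Nat.mul_le_mul (pow_le_coverCount K (by lia)) (pow_le_subspaceCard_sub_one K (by lia))
  refine le_trans ?_ (Nat.mul_le_mul_left _ h1)
  rw [nonincidenceCount, Finset.sum_mul]
  -- The constants of the three factors give `2 * 2 * 4 = 16` per dimension; the `n ≤ 2 ^ n`
  -- summands raise this to `32`.
  calc _ ≤ ∑ _k ∈ Finset.range n, 16 ^ n * Nat.card K ^ M := by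
        refine Finset.sum_le_sum fun k hk => ?_
        have hk := Finset.mem_range.1 hk
        have h2 := grassmannCard_le K (Nat.succ_le_of_lt hk)
        have h3 : grassmannCard K (k + 1) k ≤ 2 ^ k * Nat.card K ^ k := by
          simpa using grassmannCard_le K (Nat.le_succ k)
        have h4 := (Nat.sub_le _ (subspaceCard K k)).trans (subspaceCard_le K (k + 1))
        calc _ ≤ 2 ^ (k + 1) * Nat.card K ^ ((k + 1) * (n - (k + 1))) *
              (2 ^ k * Nat.card K ^ k *
                (4 ^ (k + 1) * Nat.card K ^ ((k + 1) * (k + 1) / 4))) *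
              Nat.card K ^ decayExponent n := by gcongr
          _ = 2 ^ (k + 1) * 2 ^ k * 4 ^ (k + 1) * Nat.card K ^
              ((k + 1) * (n - (k + 1)) + k + (k + 1) * (k + 1) / 4 + decayExponent n) := by
            simp only [pow_add]
            ring
          _ ≤ 2 ^ n * 2 ^ n * 4 ^ n * Nat.card K ^ M := by
            gcongr
            any_goals lia
            exact exponent_add_decayExponent_le hn hk
          _ = _ := by rw [← mul_pow, ← mul_pow]; norm_num
    _ = n * 16 ^ n * Nat.card K ^ M := by simp [mul_assoc]
    _ ≤ 2 ^ n * 16 ^ n * Nat.card K ^ M := by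
        gcongr
        exact Nat.lt_two_pow_self.le
    _ = _ := by rw [← mul_pow]; norm_num

end Bounds

/-! ### Density for elementary abelian groups -/

theorem latticeDensity_sat_subCpPow {p n : ℕ} [Fact p.Prime] (hn : 1 ≤ n) :
    latticeDensity (Sat (SubCpPow p n)) =
      1 - (nonincidenceCount (ZMod p) n : ℝ) /
        (coverCount (ZMod p) n * (subspaceCard (ZMod p) n - 1 : ℕ)) := by
  let e : SubCpPow p n ≃o Submodule (ZMod p) (Fin n → ZMod p) := AddSubgroup.toZModSubmodule p
  have h1 : Nat.card {q : SubCpPow p n × SubCpPow p n // q.1 ⋖ q.2} = coverCount (ZMod p) n := by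
    rw [coverCount, ← card_covBy_submodule]
    exact Nat.card_congr ((e.toEquiv.prodCongr e.toEquiv).subtypeEquiv fun q =>
      (apply_covBy_apply_iff e).symm)
  have h2 : Nat.card {z : SubCpPow p n // z ≠ ⊥} = subspaceCard (ZMod p) n - 1 := by
    classical
    have := Fintype.ofFinite (SubCpPow p n)
    rw [subspaceCard, ← Nat.card_congr e.toEquiv, Nat.card_eq_fintype_card,
      Nat.card_eq_fintype_card, Fintype.card_subtype_compl, Fintype.card_subtype_eq]
  have h3 : Nat.card {t : (SubCpPow p n × SubCpPow p n) × SubCpPow p n //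
      t.1.1 ⋖ t.1.2 ∧ t.2 ≤ t.1.2 ∧ ¬ t.2 ≤ t.1.1} = nonincidenceCount (ZMod p) n := by
    rw [nonincidenceCount, ← card_covBy_le_not_le_submodule]
    refine Nat.card_congr
      (((e.toEquiv.prodCongr e.toEquiv).prodCongr e.toEquiv).subtypeEquiv fun t => ?_)
    exact and_congr (apply_covBy_apply_iff e).symm
      (and_congr e.le_iff_le.symm (not_congr e.le_iff_le.symm))
  rw [Sat.latticeDensity_eq, h1, h2, h3]
  · exact h1 ▸ (coverCount_pos _ hn).ne'
  · exact h2 ▸ (subspaceCard_sub_one_pos _ hn).ne'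

theorem abs_latticeDensity_sub_one_le {p n : ℕ} [Fact p.Prime] (hn : 2 ≤ n) :
    |latticeDensity (Sat (SubCpPow p n)) - 1| ≤ 32 ^ n / (p : ℝ) ^ decayExponent n := by
  have hc := coverCount_pos (ZMod p) (show 1 ≤ n by lia)
  have hs := subspaceCard_sub_one_pos (ZMod p) (show 1 ≤ n by lia)
  have hp : 0 < p := (Fact.out : p.Prime).pos
  have h := nonincidenceCount_mul_pow_le (ZMod p) hn
  rw [Nat.card_zmod] at h
  rw [latticeDensity_sat_subCpPow (by lia), sub_right_comm, sub_self, zero_sub, abs_neg,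
    abs_of_nonneg (by positivity), div_le_div_iff₀ (by positivity) (by positivity)]
  exact_mod_cast h

theorem latticeDensity_sat_subCpPow_one {p : ℕ} [Fact p.Prime] :
    latticeDensity (Sat (SubCpPow p 1)) = 0 := by
  rw [latticeDensity_sat_subCpPow le_rfl]
  simp [nonincidenceCount, coverCount, subspaceCard_eq_sum, Finset.sum_range_succ,
    grassmannCard_zero_right, grassmannCard_self]

/-- With `g` lines there are `2g` covers, `g + 1` nonzero subspaces and `g + g²` triples; only `g >
0` matters. -/
theorem latticeDensity_sat_subCpPow_two {p : ℕ} [Fact p.Prime] :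
    latticeDensity (Sat (SubCpPow p 2)) = 1 / 2 := by
  rw [latticeDensity_sat_subCpPow (by norm_num)]
  have h : (0 : ℝ) < grassmannCard (ZMod p) 2 1 :=
    Nat.cast_pos.2 (grassmannCard_pos _ (by norm_num))
  simp only [nonincidenceCount, coverCount, subspaceCard_eq_sum, Finset.sum_range_succ,
    Finset.sum_range_zero, grassmannCard_zero_right, grassmannCard_self, zero_add, mul_one, one_mul,
    Nat.reduceAdd, Nat.reduceSub]
  rw [show 1 + grassmannCard (ZMod p) 2 1 + 1 - (1 + 1) = grassmannCard (ZMod p) 2 1 by lia,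
    show 1 + grassmannCard (ZMod p) 2 1 + 1 - 1 = grassmannCard (ZMod p) 2 1 + 1 by lia]
  push_cast
  field_simp
  ring

theorem tendsto_latticeDensity_dim {p : ℕ} (hp : p.Prime) :
    Tendsto (fun n : ℕ => latticeDensity (Sat (SubCpPow p n))) atTop (𝓝 1) := by
  have := Fact.mk hp
  have h0 : Tendsto (fun n : ℕ => (1 / 2 : ℝ) ^ n) atTop (𝓝 0) :=
    tendsto_pow_atTop_nhds_zero_of_lt_one (by norm_num) (by norm_num)
  rw [tendsto_iff_dist_tendsto_zero]
  refine squeeze_zero' (Eventually.of_forall fun _ => dist_nonneg) ?_ h0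
  -- From `40` on, the quadratic exponent exceeds `6n`, and `32 ^ n / 2 ^ (6n) = 2 ^ (-n)`.
  filter_upwards [eventually_ge_atTop 40] with n hn
  rw [Real.dist_eq]
  refine (abs_latticeDensity_sub_one_le (by lia)).trans ?_
  have hp2 : (2 : ℝ) ≤ p := by exact_mod_cast hp.two_le
  have he : 6 * n ≤ decayExponent n := by
    rw [decayExponent, Nat.le_div_iff_mul_le (by norm_num)]
    obtain ⟨m, rfl⟩ := Nat.exists_eq_add_of_le' hn
    rw [show m + 40 - 2 = m + 38 by lia]
    nlinarith
  have h1 : (2 : ℝ) ^ (6 * n) ≤ (p : ℝ) ^ decayExponent n :=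
    (pow_le_pow_right₀ (by norm_num) he).trans (pow_le_pow_left₀ (by norm_num) hp2 _)
  calc (32 : ℝ) ^ n / (p : ℝ) ^ decayExponent n ≤ 32 ^ n / 2 ^ (6 * n) := by gcongr
    _ = (1 / 2) ^ n := by rw [pow_mul, ← div_pow]; norm_num

theorem tendsto_latticeDensity_prime {n : ℕ} (hn : 3 ≤ n) :
    Tendsto (fun p : ℕ => latticeDensity (Sat (SubCpPow p n)))
      (atTop ⊓ 𝓟 {p : ℕ | p.Prime}) (𝓝 1) := by
  have h0 : Tendsto (fun p : ℕ => (32 : ℝ) ^ n / p) (atTop ⊓ 𝓟 {p : ℕ | p.Prime}) (𝓝 0) :=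
    (tendsto_const_nhds.div_atTop tendsto_natCast_atTop_atTop).mono_left inf_le_left
  rw [tendsto_iff_dist_tendsto_zero]
  refine squeeze_zero' (Eventually.of_forall fun _ => dist_nonneg) ?_ h0
  filter_upwards [mem_inf_of_right (mem_principal_self _)] with p hp
  have hp : p.Prime := hp
  have := Fact.mk hp
  rw [Real.dist_eq]
  refine (abs_latticeDensity_sub_one_le (by lia)).trans ?_
  have hp1 : (1 : ℝ) ≤ p := by exact_mod_cast hp.one_le
  have he : 1 ≤ decayExponent n := by
    rw [decayExponent, Nat.le_div_iff_mul_le (by norm_num)]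
    have := Nat.mul_pos (Nat.succ_pos n) (show 0 < n - 2 by lia)
    lia
  have h1 : (p : ℝ) ≤ (p : ℝ) ^ decayExponent n := le_self_pow₀ hp1 (by lia)
  gcongr

theorem theoremC :
    (∀ p : ℕ, p.Prime →
      Tendsto (fun n : ℕ => latticeDensity (Sat (SubCpPow p n))) atTop (𝓝 1)) ∧
    (∀ n : ℕ, 1 ≤ n →
      Tendsto (fun p : ℕ => latticeDensity (Sat (SubCpPow p n)))
        (atTop ⊓ 𝓟 {p : ℕ | p.Prime})
        (𝓝 (if n = 1 then 0 else if n = 2 then 1 / 2 else 1))) ∧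
    (∀ p : ℕ, p.Prime → latticeDensity (Sat (SubCpPow p 2)) = 1 / 2) := by
  refine ⟨fun p hp => tendsto_latticeDensity_dim hp, fun n hn => ?_, fun p hp => ?_⟩
  · have hev : ∀ᶠ p : ℕ in atTop ⊓ 𝓟 {p : ℕ | p.Prime}, p.Prime :=
      mem_inf_of_right (mem_principal_self _)
    obtain rfl | rfl | hn : n = 1 ∨ n = 2 ∨ 3 ≤ n := by lia
    · refine (tendsto_congr' (f₂ := fun _ => (0 : ℝ)) ?_).2 (by simpa using tendsto_const_nhds)
      filter_upwards [hev] with p hp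
      have := Fact.mk hp
      exact latticeDensity_sat_subCpPow_one
    · refine (tendsto_congr' (f₂ := fun _ => (1 / 2 : ℝ)) ?_).2 (by simpa using tendsto_const_nhds)
      filter_upwards [hev] with p hp
      have := Fact.mk hp
      exact latticeDensity_sat_subCpPow_two
    · rw [if_neg (by lia), if_neg (by lia)]
      exact tendsto_latticeDensity_prime hn
  · have := Fact.mk hp
    exact latticeDensity_sat_subCpPow_two
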